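/- Let $E$ be a complex Hilbert space, let $\mathbb T$ be the unit circle with normalized Lebesgue measure $m$, and let $\mathbb D$ be the open unit disc. Let $H^\infty(\mathbb T,\mathcal B(E))$ be the space of essentially bounded functions $\Phi:\mathbb T\to\mathcal B(E)$ such that, for every $x\in E$, $\Phi(\cdot)x$ is strongly measurable and $\int_{\mathbb T}\overline z^{\,n}\Phi(z)x\,dm(z)=0$ for all integers $n<0$. Equalities between operator-valued functions on $\mathbb T$ are understood almost everywhere in the strong sense, i.e. $\Phi=\Psi$ means that for each $x\in E$, $\Phi(z)x=\Psi(z)x$ for almost all $z\in\mathbb T$ (if $E$ is separable, this is the same as $\Phi=\Psi$ a.e. on $\mathbb T$). A function $\Delta\in H^\infty(\mathbb T,\mathcal B(E))$ is *inner* if $\Delta^*\Delta=I_E$ a.e. on $\mathbb T$, in the sense that for all $x,y\in E$, $\langle\Delta(z)x,\Delta(z)y\rangle=\langle x,y\rangle$ for almost all $z\in\mathbb T$ (if $E$ is separable, this is the same as $\Delta(z)^*\Delta(z)=I_E$ for almost all $z$). An inner function $\Delta$ is a *left inner divisor* of $\Phi$ if $\Phi=\Delta A$ for some $A\in H^\infty(\mathbb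 T,\mathcal B(E))$, and it is *nontrivial* if it is not equal to a constant unitary operator. Functions $\Phi,\Psi\in H^\infty(\mathbb T,\mathcal B(E))$ are *left coprime* if they have no common nontrivial left inner divisor. For $\zeta\in\mathbb D$, let $P[\Phi](\zeta)\in\mathcal B(E)$ be the Poisson integral $$P[\Phi](\zeta)x=\int_{\mathbb T}\frac{1-|\zeta|^2}{|z-\zeta|^2}\,\Phi(z)x\,dm(z)\qquad(x\in E).$$ **Theorem.** Let $\Phi\in H^\infty(\mathbb T,\mathcal B(E))$ and let $\Theta=\theta I_E$, where $\theta(z)=\nu\prod_{m=1}^{M}\frac{z-\alpha_m}{1-\overline{\alpha_m}z}$ (with $M\ge 0$, $|\nu|=1$ and $\alpha_1,\dots,\alpha_M\in\mathbb D$) is a finite Blaschke product. Then $\Phi$ and $\Theta$ are left coprime if and only if $P[\Phi](\alpha)$ has dense range for every $\alpha\in\mathbb D$ with $\theta(\alpha)=0$. -/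

import Mathlib

open MeasureTheory

namespace OpHardy

/-! The unit circle `𝕋` is parametrized by `UnitAddCircle = ℝ / ℤ` through `t ↦ z = e^{2πit}`
(`AddCircle.toCircle`); `AddCircle.haarAddCircle` is its normalized Lebesgue measure, and
`fourierCoeff f n = ∫ z⁻ⁿ f dm` (a Bochner integral). -/

section Functions

variable {D D' E : Type*}
  [NormedAddCommGroup D] [InnerProductSpace ℂ D]
  [NormedAddCommGroup D'] [InnerProductSpace ℂ D']
  [NormedAddCommGroup E] [InnerProductSpace ℂ E]

/-- Equality of operator-valued functions on `𝕋` as strong functions: `Φ(·)x = Ψ(·)x` almost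
everywhere, for each vector `x`. On a separable space this is equality a.e. on `𝕋`
(`strongEq_iff`). -/
def StrongEq (Φ Ψ : UnitAddCircle → D →L[ℂ] E) : Prop :=
  ∀ x : D, ∀ᵐ t ∂(AddCircle.haarAddCircle : Measure UnitAddCircle), Φ t x = Ψ t x

/-- `Φ ∈ H^∞(𝕋, B(D,E))`: `Φ` is SOT-measurable, essentially bounded, and its Fourier coefficients
of negative index vanish. -/
structure MemHInfty (Φ : UnitAddCircle → D →L[ℂ] E) : Prop where
  measurable : ∀ x : D, AEStronglyMeasurable (fun t => Φ t x)
    (AddCircle.haarAddCircle : Measure UnitAddCircle)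
  bounded : ∃ C : ℝ, ∀ᵐ t ∂(AddCircle.haarAddCircle : Measure UnitAddCircle), ‖Φ t‖ ≤ C
  analytic : ∀ n : ℤ, n < 0 → ∀ x : D, fourierCoeff (fun t => Φ t x) n = 0

/-- `Δ ∈ H^∞(𝕋, B(D,E))` is inner: `Δ^*Δ = I_D` a.e. on `𝕋`. The equation is tested on pairs of
vectors, so that it depends on `Δ` only up to `StrongEq`; for separable `D` it is the operator
equation a.e. (`adjoint_comp_self_iff`). -/
structure IsInner (Δ : UnitAddCircle → D →L[ℂ] E) : Prop where
  mem : MemHInfty Δ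
  isometric : ∀ x y : D, ∀ᵐ t ∂(AddCircle.haarAddCircle : Measure UnitAddCircle),
    inner ℂ (Δ t x) (Δ t y) = inner ℂ x y

/-- `Δ` is a left inner divisor of `Φ`: `Δ` is inner and `Φ = Δ A` for some `A ∈ H^∞`. -/
def IsLeftInnerDivisor (Δ : UnitAddCircle → D' →L[ℂ] E) (Φ : UnitAddCircle → D →L[ℂ] E) : Prop :=
  IsInner Δ ∧ ∃ A : UnitAddCircle → D →L[ℂ] D', MemHInfty A ∧ StrongEq Φ (fun t => Δ t ∘L A t)

/-- The Poisson integral `P[Φ](ζ)x = ∫ (1 - |ζ|²) / |z - ζ|² Φ(z)x dm(z)`, for `ζ` in the open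
unit disc. -/
noncomputable def poissonIntegral (Φ : UnitAddCircle → D →L[ℂ] E) (ζ : ℂ) (x : D) : E :=
  ∫ t, poissonKernel 0 ζ (AddCircle.toCircle t : ℂ) • Φ t x
    ∂(AddCircle.haarAddCircle : Measure UnitAddCircle)

/-- The constant function with value a unitary operator. -/
def IsUnitaryConstant [CompleteSpace E] (Δ : UnitAddCircle → E →L[ℂ] E) : Prop :=
  ∃ V ∈ unitary (E →L[ℂ] E), StrongEq Δ (fun _ => V)

/-- A nontrivial left inner divisor of `Φ`: a `B(E)`-valued left inner divisor that is not a
unitary constant. -/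
def IsNontrivialLeftInnerDivisor [CompleteSpace E] (Δ : UnitAddCircle → E →L[ℂ] E)
    (Φ : UnitAddCircle → D →L[ℂ] E) : Prop :=
  IsLeftInnerDivisor Δ Φ ∧ ¬ IsUnitaryConstant Δ

/-- `Φ` and `Ψ` are left coprime: they have no common nontrivial left inner divisor. -/
def LeftCoprime [CompleteSpace E] (Φ : UnitAddCircle → D →L[ℂ] E)
    (Ψ : UnitAddCircle → D' →L[ℂ] E) : Prop :=
  ¬ ∃ Δ : UnitAddCircle → E →L[ℂ] E,
    IsNontrivialLeftInnerDivisor Δ Φ ∧ IsNontrivialLeftInnerDivisor Δ Ψ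

theorem strongEq_iff [TopologicalSpace.SeparableSpace D] (Φ Ψ : UnitAddCircle → D →L[ℂ] E) :
    StrongEq Φ Ψ ↔
      ∀ᵐ t ∂(AddCircle.haarAddCircle : Measure UnitAddCircle), Φ t = Ψ t := by
  constructor
  · intro h
    have h' := ae_all_iff.2 fun n : ℕ => h (TopologicalSpace.denseSeq D n)
    filter_upwards [h'] with t ht
    have : (Φ t : D → E) = Ψ t :=
      (TopologicalSpace.denseRange_denseSeq D).equalizer (Φ t).continuous (Ψ t).continuous
        (funext ht)
    exact DFunLike.coe_injective this
  · intro h x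
    filter_upwards [h] with t ht
    rw [ht]

theorem adjoint_comp_self_iff [CompleteSpace D] [CompleteSpace E]
    [TopologicalSpace.SeparableSpace D] (Δ : UnitAddCircle → D →L[ℂ] E) :
    (∀ x y : D, ∀ᵐ t ∂(AddCircle.haarAddCircle : Measure UnitAddCircle),
      inner ℂ (Δ t x) (Δ t y) = inner ℂ x y) ↔
    ∀ᵐ t ∂(AddCircle.haarAddCircle : Measure UnitAddCircle),
      ContinuousLinearMap.adjoint (Δ t) ∘L Δ t = ContinuousLinearMap.id ℂ D := by
  constructor
  · intro h
    have h' := ae_all_iff.2 fun n : ℕ => ae_all_iff.2 fun k : ℕ =>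
      h (TopologicalSpace.denseSeq D n) (TopologicalSpace.denseSeq D k)
    filter_upwards [h'] with t ht
    have hd := TopologicalSpace.denseRange_denseSeq D
    have h1 : ∀ n, (fun y => inner ℂ (Δ t (TopologicalSpace.denseSeq D n)) (Δ t y)) =
        fun y => inner ℂ (TopologicalSpace.denseSeq D n) y := fun n =>
      hd.equalizer (by fun_prop) (by fun_prop) (funext (ht n))
    have h2 : ∀ y, (fun x => inner ℂ (Δ t x) (Δ t y)) = fun x => inner ℂ x y := fun y =>
      hd.equalizer (by fun_prop) (by fun_prop) (funext fun n => congrFun (h1 n) y)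
    ext x
    refine ext_inner_right ℂ fun y => ?_
    simpa [ContinuousLinearMap.adjoint_inner_left] using congrFun (h2 y) x
  · intro h x y
    filter_upwards [h] with t ht
    rw [← ContinuousLinearMap.adjoint_inner_left, ← ContinuousLinearMap.comp_apply, ht]
    rfl

end Functions

/-- The Blaschke factor `b_α(z) = (z - α) / (1 - ᾱ z)`. -/
noncomputable def blaschkeFactor (α z : ℂ) : ℂ :=
  (z - α) / (1 - (starRingEnd ℂ) α * z)

/-- On the closed unit disc, `θ` is a finite Blaschke product `ν ∏ b_{α_m}`, with `|ν| = 1` and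
`α_m` in the open unit disc (repetitions and the empty product are allowed). -/
def IsFiniteBlaschkeProduct (θ : ℂ → ℂ) : Prop :=
  ∃ (ν : ℂ) (n : ℕ) (a : Fin n → ℂ), ‖ν‖ = 1 ∧ (∀ m, ‖a m‖ < 1) ∧
    ∀ z : ℂ, ‖z‖ ≤ 1 → θ z = ν * ∏ m, blaschkeFactor (a m) z

end OpHardy

/-! Two facts about H^∞ carry the proof. The Poisson integral at a point α of the disc is
multiplicative (`poissonVec_hInfty_apply`), and a function whose Poisson integral vanishes at α is
divisible by the Blaschke factor b_α (`MemHardy.blaschkeFactor_inv_smul`).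

Suppose θ(α) = 0 and P[Φ](α) does not have dense range. Let Q be the projection onto the orthogonal
complement of that range. Then QΦ and Qθ vanish at α, so b_α Q + (1 - Q) divides both Φ and θI on
the left; its Poisson integral at α kills the range of Q, so it is not a unitary constant.

Conversely, let Φ = ΔA and θI = ΔB with Δ inner. Since P[Φ](α) = P[Δ](α)P[A](α), the operator
P[Δ](α) has dense range at each zero α. As Δ is isometric, also BΔ = θI, so P[B](α)P[Δ](α) = 0 and
hence P[B](α) = 0: a factor b_α cancels from both B and θ. After all factors are removed, ΔB is a
unimodular constant, and comparing Fourier coefficients shows that Δ is a unitary constant. -/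

namespace OpHardy

open Filter Topology

local notation "μ𝕋" => (AddCircle.haarAddCircle : Measure UnitAddCircle)

/-! ### Strong measurability and almost-everywhere statements without separability -/

section Measurability

variable {α D E : Type*} [MeasurableSpace α] {μ : Measure α}
  [NormedAddCommGroup D] [NormedSpace ℂ D] [NormedAddCommGroup E] [NormedSpace ℂ E]

/-- The null set in `h` depends on the vector, but simple approximations of `f` use only countably
many vectors, and closedness passes to the limit. This replaces separability of the space when
strong identities are applied to functions. -/
theorem ae_apply_of_forall_ae {D : Type*} [NormedAddCommGroup D] {p : α → D → Prop}
    (hc : ∀ t, IsClosed {x | p t x})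
    (h : ∀ x, ∀ᵐ t ∂μ, p t x) {f : α → D} (hf : AEStronglyMeasurable f μ) :
    ∀ᵐ t ∂μ, p t (f t) := by
  obtain ⟨g, hg, hfg⟩ := hf
  have key : ∀ᵐ t ∂μ, ∀ n, p t (hg.approx n t) := by
    refine ae_all_iff.2 fun n => ?_
    have : ∀ᵐ t ∂μ, ∀ x ∈ (hg.approx n).range, p t x :=
      (ae_ball_iff (hg.approx n).range.countable_toSet).2 fun x _ => h x
    filter_upwards [this] with t ht
    exact ht _ (SimpleFunc.mem_range_self _ t)
  filter_upwards [key, hfg] with t ht hfgt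
  rw [hfgt]
  exact (hc t).mem_of_tendsto (hg.tendsto_approx t) (Eventually.of_forall ht)

theorem aestronglyMeasurable_clm_apply {K : α → D →L[ℂ] E}
    (hK : ∀ x, AEStronglyMeasurable (fun t => K t x) μ) {f : α → D}
    (hf : AEStronglyMeasurable f μ) : AEStronglyMeasurable (fun t => K t (f t)) μ := by
  have simple : ∀ s : SimpleFunc α D, AEStronglyMeasurable (fun t => K t (s t)) μ := by
    intro s
    induction s using SimpleFunc.induction with
    | @const c s hs =>
      have : (fun t => K t ((SimpleFunc.piecewise s hs (SimpleFunc.const α c)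
          (SimpleFunc.const α 0)) t)) = s.indicator fun t => K t c := by
        ext t
        by_cases ht : t ∈ s <;> simp [ht]
      rw [this]
      exact (hK c).indicator hs
    | add _ h₁ h₂ =>
      simp only [SimpleFunc.coe_add, Pi.add_apply, map_add]
      exact h₁.add h₂
  obtain ⟨g, hg, hfg⟩ := hf
  refine aestronglyMeasurable_of_tendsto_ae atTop (fun n => simple (hg.approx n)) ?_
  filter_upwards [hfg] with t ht
  rw [ht]
  exact ((K t).continuous.tendsto _).comp (hg.tendsto_approx t)

end Measurability

/-! ### Vector-valued Hardy functions and density of analytic polynomials -/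

section Hardy

variable {D E : Type*}
  [NormedAddCommGroup D] [InnerProductSpace ℂ D]
  [NormedAddCommGroup E] [InnerProductSpace ℂ E]

theorem StrongEq.ae_apply {Φ Ψ : UnitAddCircle → D →L[ℂ] E} (h : StrongEq Φ Ψ)
    {f : UnitAddCircle → D} (hf : AEStronglyMeasurable f μ𝕋) :
    ∀ᵐ t ∂μ𝕋, Φ t (f t) = Ψ t (f t) :=
  ae_apply_of_forall_ae (fun t => isClosed_eq (Φ t).continuous (Ψ t).continuous) h hf

theorem IsInner.ae_inner_apply {Δ : UnitAddCircle → D →L[ℂ] E} (h : IsInner Δ)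
    {f g : UnitAddCircle → D} (hf : AEStronglyMeasurable f μ𝕋) (hg : AEStronglyMeasurable g μ𝕋) :
    ∀ᵐ t ∂μ𝕋, inner ℂ (Δ t (f t)) (Δ t (g t)) = inner ℂ (f t) (g t) := by
  refine ae_apply_of_forall_ae (p := fun t y => inner ℂ (Δ t (f t)) (Δ t y) = inner ℂ (f t) y)
    (fun t => isClosed_eq (by fun_prop) (by fun_prop)) (fun y => ?_) hg
  exact ae_apply_of_forall_ae (p := fun t x => inner ℂ (Δ t x) (Δ t y) = inner ℂ x y)
    (fun t => isClosed_eq (by fun_prop) (by fun_prop)) (fun x => h.isometric x y) hf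

theorem IsInner.ae_norm_apply {Δ : UnitAddCircle → D →L[ℂ] E} (h : IsInner Δ)
    {f : UnitAddCircle → D} (hf : AEStronglyMeasurable f μ𝕋) :
    ∀ᵐ t ∂μ𝕋, ‖Δ t (f t)‖ = ‖f t‖ := by
  filter_upwards [h.ae_inner_apply hf hf] with t ht
  rw [@norm_eq_sqrt_re_inner ℂ, @norm_eq_sqrt_re_inner ℂ, ht]

/-- Bounded vector-valued functions on the circle whose negative Fourier coefficients vanish. -/
structure MemHardy (f : UnitAddCircle → E) : Prop where
  measurable : AEStronglyMeasurable f μ𝕋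
  bounded : ∃ C : ℝ, ∀ᵐ t ∂μ𝕋, ‖f t‖ ≤ C
  analytic : ∀ n : ℤ, n < 0 → fourierCoeff f n = 0

theorem MemHInfty.apply {Φ : UnitAddCircle → D →L[ℂ] E} (h : MemHInfty Φ) (x : D) :
    MemHardy fun t => Φ t x where
  measurable := h.measurable x
  bounded := by
    obtain ⟨C, hC⟩ := h.bounded
    refine ⟨C * ‖x‖, ?_⟩
    filter_upwards [hC] with t ht
    exact (Φ t).le_of_opNorm_le ht x
  analytic n hn := h.analytic n hn x

theorem MemHardy.memLp {f : UnitAddCircle → E} (hf : MemHardy f) (p : ENNReal) :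
    MemLp f p μ𝕋 :=
  let ⟨C, hC⟩ := hf.bounded
  MemLp.of_bound hf.measurable C hC

theorem MemHardy.integrable {f : UnitAddCircle → E} (hf : MemHardy f) : Integrable f μ𝕋 :=
  memLp_one_iff_integrable.1 (hf.memLp 1)

theorem inner_fourierCoeff [CompleteSpace E] {f : UnitAddCircle → E} (hf : Integrable f μ𝕋)
    (y : E) (n : ℤ) :
    fourierCoeff (fun t => inner ℂ y (f t)) n = inner ℂ y (fourierCoeff f n) := by
  rw [fourierCoeff, fourierCoeff, ← integral_inner (hf.fourier_smul (-n))]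
  simp only [inner_smul_right, smul_eq_mul]

theorem ae_eq_zero_of_fourierCoeff_eq_zero_scalar {f : UnitAddCircle → ℂ} (hf : MemLp f 2 μ𝕋)
    (h : ∀ n, fourierCoeff f n = 0) : f =ᵐ[μ𝕋] 0 := by
  have h0 : hf.toLp f = 0 := by
    apply fourierBasis.repr.injective
    ext n
    rw [fourierBasis_repr, fourierCoeff_congr_ae hf.coeFn_toLp, h, map_zero]
    rfl
  exact hf.coeFn_toLp.symm.trans (h0 ▸ Lp.coeFn_zero ℂ 2 μ𝕋)

/-- Pairing with a fixed vector reduces to the scalar case; the essential range is separable, so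
these pairings detect vanishing almost everywhere. -/
theorem ae_eq_zero_of_fourierCoeff_eq_zero [CompleteSpace E] {f : UnitAddCircle → E}
    (hf : MemLp f 2 μ𝕋) (h : ∀ n, fourierCoeff f n = 0) : f =ᵐ[μ𝕋] 0 := by
  obtain ⟨s, hs, hfs⟩ := hf.1.isSeparable_ae_range
  refine ae_eq_zero_of_forall_dual_of_isSeparable ℂ hs (fun c => ?_) hfs
  obtain ⟨y, rfl⟩ := (InnerProductSpace.toDual ℂ E).surjective c
  simp only [InnerProductSpace.toDual_apply_apply]
  refine ae_eq_zero_of_fourierCoeff_eq_zero_scalar (hf.const_inner y) fun n => ?_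
  rw [inner_fourierCoeff (hf.integrable one_le_two), h, inner_zero_right]

/-- The analytic monomials `zᵐ x` in the Hilbert space of square-integrable functions. -/
def analyticMonomials (E : Type*) [NormedAddCommGroup E] [InnerProductSpace ℂ E] :
    Set (Lp E 2 μ𝕋) :=
  {g | ∃ (m : ℕ) (x : E), g =ᵐ[μ𝕋] fun t => fourier (m : ℤ) t • x}

theorem memLp_fourier_smul (n : ℤ) (x : E) (p : ENNReal) :
    MemLp (fun t => fourier n t • x) p μ𝕋 :=
  MemLp.of_bound (Continuous.aestronglyMeasurable (by fun_prop)) ‖x‖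
    (Eventually.of_forall fun t => by rw [norm_smul, fourier_apply, Circle.norm_coe, one_mul])

theorem inner_monomial [CompleteSpace E] {g : Lp E 2 μ𝕋} {n : ℤ} {x : E}
    (hg : g =ᵐ[μ𝕋] fun t => fourier n t • x) (h : Lp E 2 μ𝕋) :
    inner ℂ g h = inner ℂ x (fourierCoeff h n) := by
  rw [L2.inner_def, ← inner_fourierCoeff ((Lp.memLp h).integrable one_le_two), fourierCoeff]
  refine integral_congr_ae ?_
  filter_upwards [hg] with t ht
  rw [ht, inner_smul_left, fourier_neg, smul_eq_mul]

/-- Let q be the component of f orthogonal to the closed span. Its coefficients of index n ≥ 0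
vanish by orthogonality to the monomials; those of index n < 0 vanish because neither f nor its
projection has any. Hence q = 0. -/
theorem MemHardy.toLp_mem_closure [CompleteSpace E] {f : UnitAddCircle → E} (hf : MemHardy f) :
    (hf.memLp 2).toLp f ∈ (Submodule.span ℂ (analyticMonomials E)).topologicalClosure := by
  set S := (Submodule.span ℂ (analyticMonomials E)).topologicalClosure
  have : CompleteSpace S := (Submodule.isClosed_topologicalClosure _).completeSpace_coe
  obtain ⟨p, hp, q, hq, hpq⟩ := S.exists_add_mem_mem_orthogonal ((hf.memLp 2).toLp f)
  have coeff_q : ∀ n, fourierCoeff q n = 0 := by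
    intro n
    have hmono : ∀ x : E, ∃ g : Lp E 2 μ𝕋, g =ᵐ[μ𝕋] fun t => fourier n t • x := fun x =>
      ⟨(memLp_fourier_smul n x 2).toLp _, MemLp.coeFn_toLp _⟩
    refine ext_inner_left ℂ fun x => ?_
    obtain ⟨g, hg⟩ := hmono x
    rw [← inner_monomial hg, inner_zero_right]
    rcases le_or_gt 0 n with hn | hn
    · obtain ⟨m, rfl⟩ := Int.eq_ofNat_of_zero_le hn
      exact (S.mem_orthogonal q).1 hq g
        (Submodule.le_topologicalClosure _ (Submodule.subset_span ⟨m, x, hg⟩))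
    · have h1 : inner ℂ g ((hf.memLp 2).toLp f) = 0 := by
        rw [inner_monomial hg, fourierCoeff_congr_ae (MemLp.coeFn_toLp _), hf.analytic n hn,
          inner_zero_right]
      have h2 : S ≤ (innerSL ℂ g).ker := by
        refine Submodule.topologicalClosure_minimal _ (Submodule.span_le.2 ?_)
          (innerSL ℂ g).isClosed_ker
        rintro k ⟨m, y, hk⟩
        have hne : (m : ℤ) ≠ n := by omega
        change inner ℂ g k = 0
        rw [inner_monomial hg, fourierCoeff_congr_ae hk]
        have : fourierCoeff (fun t : UnitAddCircle => fourier (m : ℤ) t • y) n = 0 := by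
          simp only [fourierCoeff, smul_smul]
          rw [integral_smul_const]
          have := congrFun (fourierCoeff_fourier (T := 1) (m : ℤ)) n
          simp only [fourierCoeff, smul_eq_mul] at this
          rw [this, Pi.single_eq_of_ne hne.symm, zero_smul]
        rw [this, inner_zero_right]
      have h3 : inner ℂ g p = 0 := h2 hp
      rw [hpq, inner_add_right, h3, zero_add] at h1
      exact h1
  have hq0 : q = 0 := by
    ext1
    exact (ae_eq_zero_of_fourierCoeff_eq_zero (Lp.memLp q) coeff_q).trans
      (Lp.coeFn_zero _ _ _).symm
  rw [hpq, hq0, add_zero]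
  exact hp

theorem integrable_clm_apply {K : UnitAddCircle → D →L[ℂ] E}
    (hK : ∀ x, AEStronglyMeasurable (fun t => K t x) μ𝕋) {C : ℝ} (hC : ∀ᵐ t ∂μ𝕋, ‖K t‖ ≤ C)
    {f : UnitAddCircle → D} (hf : Integrable f μ𝕋) : Integrable (fun t => K t (f t)) μ𝕋 := by
  refine (hf.norm.const_mul C).mono' (aestronglyMeasurable_clm_apply hK hf.1) ?_
  filter_upwards [hC] with t ht
  exact (K t).le_of_opNorm_le ht _

theorem integral_norm_le_norm_Lp {E : Type*} [NormedAddCommGroup E] (g : Lp E 2 μ𝕋) :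
    ∫ t, ‖g t‖ ∂μ𝕋 ≤ ‖g‖ := by
  rw [integral_norm_eq_lintegral_enorm (Lp.memLp g).1, Lp.norm_def,
    ← eLpNorm_one_eq_lintegral_enorm]
  exact ENNReal.toReal_mono (Lp.eLpNorm_ne_top g)
    (eLpNorm_le_eLpNorm_of_exponent_le one_le_two (Lp.memLp g).1)

/-- A bounded strongly measurable kernel that annihilates the analytic monomials annihilates the
vector-valued Hardy space. -/
theorem MemHardy.integral_clm_apply_eq_zero [CompleteSpace D] [CompleteSpace E]
    {K : UnitAddCircle → D →L[ℂ] E}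
    (hK : ∀ x, AEStronglyMeasurable (fun t => K t x) μ𝕋) (hb : ∃ C : ℝ, ∀ᵐ t ∂μ𝕋, ‖K t‖ ≤ C)
    (h : ∀ (m : ℕ) (x : D), ∫ t, fourier (m : ℤ) t • K t x ∂μ𝕋 = 0)
    {f : UnitAddCircle → D} (hf : MemHardy f) : ∫ t, K t (f t) ∂μ𝕋 = 0 := by
  obtain ⟨C, hC⟩ := hb
  have hint (g : Lp D 2 μ𝕋) : Integrable (fun t => K t (g t)) μ𝕋 :=
    integrable_clm_apply hK hC ((Lp.memLp g).integrable one_le_two)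
  let Λ₀ : Lp D 2 μ𝕋 →ₗ[ℂ] E :=
    { toFun := fun g => ∫ t, K t (g t) ∂μ𝕋
      map_add' := fun g₁ g₂ => by
        rw [← integral_add (hint g₁) (hint g₂)]
        refine integral_congr_ae ?_
        filter_upwards [Lp.coeFn_add g₁ g₂] with t ht
        rw [ht, Pi.add_apply, map_add]
      map_smul' := fun c g => by
        rw [RingHom.id_apply, ← integral_smul]
        refine integral_congr_ae ?_
        filter_upwards [Lp.coeFn_smul c g] with t ht
        rw [ht, Pi.smul_apply, map_smul] }
  have hΛ₀ (g : Lp D 2 μ𝕋) : ‖Λ₀ g‖ ≤ |C| * ‖g‖ := by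
    calc ‖Λ₀ g‖ ≤ ∫ t, ‖K t (g t)‖ ∂μ𝕋 := norm_integral_le_integral_norm _
      _ ≤ ∫ t, |C| * ‖g t‖ ∂μ𝕋 := by
        refine integral_mono_ae (hint g).norm
          (((Lp.memLp g).integrable one_le_two).norm.const_mul _) ?_
        filter_upwards [hC] with t ht
        exact (K t).le_of_opNorm_le (ht.trans (le_abs_self C)) _
      _ = |C| * ∫ t, ‖g t‖ ∂μ𝕋 := integral_const_mul _ _
      _ ≤ |C| * ‖g‖ := by gcongr; exact integral_norm_le_norm_Lp g
  -- Continuity on L² makes the kernel closed, so it contains the closure of the span once it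
  -- contains the monomials.
  let Λ : Lp D 2 μ𝕋 →L[ℂ] E := Λ₀.mkContinuous |C| hΛ₀
  have hker : (Submodule.span ℂ (analyticMonomials D)).topologicalClosure ≤ Λ.ker := by
    refine Submodule.topologicalClosure_minimal _ (Submodule.span_le.2 ?_) Λ.isClosed_ker
    rintro g ⟨m, x, hg⟩
    change ∫ t, K t (g t) ∂μ𝕋 = 0
    rw [← h m x]
    refine integral_congr_ae ?_
    filter_upwards [hg] with t ht
    rw [ht, map_smul]
  have : ∫ t, K t ((hf.memLp 2).toLp f t) ∂μ𝕋 = 0 := hker hf.toLp_mem_closure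
  rw [← this]
  refine integral_congr_ae ?_
  filter_upwards [(hf.memLp 2).coeFn_toLp] with t ht
  rw [ht]

end Hardy

/-! ### Circle averages and the Poisson formula -/

section Circle

theorem coe_fourier (n : ℤ) (t : UnitAddCircle) :
    fourier n t = (AddCircle.toCircle t : ℂ) ^ n := by
  rw [fourier_apply, AddCircle.toCircle_zsmul, Circle.coe_zpow]

theorem integral_toCircle {E : Type*} [NormedAddCommGroup E] [NormedSpace ℝ E] (g : ℂ → E) :
    ∫ t, g (AddCircle.toCircle t : ℂ) ∂μ𝕋 = Real.circleAverage g 0 1 := by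
  rw [AddCircle.integral_haarAddCircle, inv_one, one_smul,
    ← AddCircle.intervalIntegral_preimage (1 : ℝ) 0, zero_add, Real.circleAverage]
  have h := intervalIntegral.smul_integral_comp_mul_left (a := 0) (b := 1)
    (fun θ => g (circleMap 0 1 θ)) (2 * Real.pi)
  rw [mul_zero, mul_one] at h
  rw [← h, inv_smul_smul₀ (by positivity)]
  congr 1
  ext x
  simp [AddCircle.toCircle_apply_mk, circleMap, Circle.coe_exp]

theorem norm_toCircle (t : UnitAddCircle) : ‖(AddCircle.toCircle t : ℂ)‖ = 1 :=
  Circle.norm_coe _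

theorem continuous_comp_toCircle {q : ℂ → ℂ} (hq : DiffContOnCl ℂ q (Metric.ball 0 1)) :
    Continuous fun t : UnitAddCircle => q (AddCircle.toCircle t : ℂ) := by
  refine hq.continuousOn_ball.comp_continuous
    (continuous_subtype_val.comp AddCircle.continuous_toCircle) fun t => ?_
  rw [mem_closedBall_zero_iff, norm_toCircle]

theorem continuous_poissonKernel_toCircle {α : ℂ} (hα : ‖α‖ < 1) :
    Continuous fun t : UnitAddCircle => poissonKernel 0 α (AddCircle.toCircle t : ℂ) := by
  have hc : Continuous fun t : UnitAddCircle => (AddCircle.toCircle t : ℂ) :=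
    continuous_subtype_val.comp AddCircle.continuous_toCircle
  simp only [poissonKernel_def]
  refine Continuous.div (by fun_prop) (by fun_prop) fun t => ?_
  rw [sub_zero, sub_zero]
  refine pow_ne_zero 2 (norm_ne_zero_iff.2 (sub_ne_zero.2 fun h => ?_))
  rw [← h, norm_toCircle] at hα
  exact hα.false

theorem exists_norm_le_of_continuous {G : Type*} [NormedAddCommGroup G] {q : UnitAddCircle → G}
    (hq : Continuous q) : ∃ C : ℝ, ∀ t, ‖q t‖ ≤ C :=
  let ⟨C, hC⟩ := isCompact_univ.exists_bound_of_continuousOn hq.continuousOn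
  ⟨C, fun t => hC t trivial⟩

theorem integral_poissonKernel_smul {E : Type*} [NormedAddCommGroup E] [NormedSpace ℂ E]
    [CompleteSpace E] {α : ℂ} (hα : ‖α‖ < 1) {q : ℂ → E}
    (hq : DiffContOnCl ℂ q (Metric.ball 0 1)) :
    ∫ t, poissonKernel 0 α (AddCircle.toCircle t : ℂ) • q (AddCircle.toCircle t : ℂ) ∂μ𝕋 = q α := by
  rw [integral_toCircle fun z => poissonKernel 0 α z • q z]
  exact hq.circleAverage_poissonKernel_smul (mem_ball_zero_iff.2 hα)

theorem diffContOnCl_pow (m : ℕ) : DiffContOnCl ℂ (fun z : ℂ => z ^ m) (Metric.ball 0 1) :=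
  (differentiable_id.pow m).diffContOnCl

end Circle

/-! ### Products in H^∞ and multiplicativity of the Poisson integral -/

section Hardy

variable {D E F : Type*}
  [NormedAddCommGroup D] [InnerProductSpace ℂ D]
  [NormedAddCommGroup E] [InnerProductSpace ℂ E]
  [NormedAddCommGroup F] [InnerProductSpace ℂ F]

theorem MemHardy.add {f g : UnitAddCircle → E} (hf : MemHardy f) (hg : MemHardy g) :
    MemHardy (f + g) where
  measurable := hf.measurable.add hg.measurable
  bounded := by
    obtain ⟨C, hC⟩ := hf.bounded
    obtain ⟨C', hC'⟩ := hg.bounded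
    refine ⟨C + C', ?_⟩
    filter_upwards [hC, hC'] with t h h'
    exact norm_add_le_of_le h h'
  analytic n hn := by
    rw [fourierCoeff.add hf.integrable hg.integrable, Pi.add_apply, hf.analytic n hn,
      hg.analytic n hn, add_zero]

theorem memHInfty_of_apply {Φ : UnitAddCircle → D →L[ℂ] E} (h : ∀ x, MemHardy fun t => Φ t x)
    (hb : ∃ C : ℝ, ∀ᵐ t ∂μ𝕋, ‖Φ t‖ ≤ C) : MemHInfty Φ where
  measurable x := (h x).measurable
  bounded := hb
  analytic n hn x := (h x).analytic n hn

theorem memHInfty_const [CompleteSpace E] (T : D →L[ℂ] E) : MemHInfty fun _ => T where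
  measurable _ := aestronglyMeasurable_const
  bounded := ⟨‖T‖, Eventually.of_forall fun _ => le_rfl⟩
  analytic n hn x := by
    have := congrFun (fourierCoeff_fourier (T := 1) 0) n
    simp only [fourierCoeff, fourier_zero, smul_eq_mul, mul_one] at this
    rw [fourierCoeff, integral_smul_const, this, Pi.single_eq_of_ne hn.ne, zero_smul]

theorem memHInfty_smul_id [CompleteSpace E] {q : ℂ → ℂ}
    (hq : DiffContOnCl ℂ q (Metric.ball 0 1)) :
    MemHInfty fun t => q (AddCircle.toCircle t : ℂ) • ContinuousLinearMap.id ℂ E where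
  measurable x := by
    have := continuous_comp_toCircle hq
    exact (this.smul continuous_const).aestronglyMeasurable
  bounded := by
    have := continuous_comp_toCircle hq
    obtain ⟨C, hC⟩ := exists_norm_le_of_continuous
      (this.smul (continuous_const (y := ContinuousLinearMap.id ℂ E)))
    exact ⟨C, Eventually.of_forall hC⟩
  analytic n hn x := by
    obtain ⟨m, hm⟩ := Int.eq_ofNat_of_zero_le (show 0 ≤ -n by omega)
    -- The coefficient of index -m is the mean of z^m q(z)x over the circle, hence its value at 0,
    -- which is zero because m > 0.
    have hd : DiffContOnCl ℂ (fun z => (z ^ m * q z) • x) (Metric.ball 0 1) :=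
      ((diffContOnCl_pow m).smul hq).smul_const x
    have h := integral_toCircle fun z => (z ^ m * q z) • x
    rw [DiffContOnCl.circleAverage (by simpa using hd), zero_pow (by omega), zero_mul,
      zero_smul] at h
    simpa only [fourierCoeff, hm, coe_fourier, zpow_natCast, smul_smul,
      smul_apply, ContinuousLinearMap.id_apply] using h

theorem MemHardy.hInfty_apply [CompleteSpace D] [CompleteSpace E]
    {Φ : UnitAddCircle → D →L[ℂ] E} (hΦ : MemHInfty Φ) {f : UnitAddCircle → D}
    (hf : MemHardy f) : MemHardy fun t => Φ t (f t) where
  measurable := aestronglyMeasurable_clm_apply hΦ.measurable hf.measurable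
  bounded := by
    obtain ⟨C, hC⟩ := hΦ.bounded
    obtain ⟨C', hC'⟩ := hf.bounded
    refine ⟨C * C', ?_⟩
    filter_upwards [hC, hC'] with t h h'
    exact (Φ t).le_of_opNorm_le_of_le h h'
  analytic n hn := by
    have hfc : Continuous fun t : UnitAddCircle => fourier (-n) t := by fun_prop
    -- On a monomial z^m x this kernel gives the coefficient of Φx of index n - m, still negative.
    refine MemHardy.integral_clm_apply_eq_zero (K := fun t => fourier (-n) t • Φ t)
      (fun x => hfc.aestronglyMeasurable.smul (hΦ.measurable x)) ?_ (fun m x => ?_) hf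
    · obtain ⟨C, hC⟩ := hΦ.bounded
      refine ⟨C, ?_⟩
      filter_upwards [hC] with t ht
      rwa [norm_smul, fourier_apply, Circle.norm_coe, one_mul]
    · have := hΦ.analytic (n - m) (by omega) x
      rw [fourierCoeff, neg_sub] at this
      rw [← this]
      congr 1
      ext t
      rw [smul_apply, smul_smul, ← fourier_add, sub_eq_add_neg]

theorem MemHInfty.comp [CompleteSpace E] [CompleteSpace F] {Φ : UnitAddCircle → E →L[ℂ] F}
    {Ψ : UnitAddCircle → D →L[ℂ] E} (hΦ : MemHInfty Φ) (hΨ : MemHInfty Ψ) :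
    MemHInfty fun t => Φ t ∘L Ψ t := by
  refine memHInfty_of_apply (fun x => (hΨ.apply x).hInfty_apply hΦ) ?_
  obtain ⟨C, hC⟩ := hΦ.bounded
  obtain ⟨C', hC'⟩ := hΨ.bounded
  refine ⟨C * C', ?_⟩
  filter_upwards [hC, hC'] with t h h'
  exact (ContinuousLinearMap.opNorm_comp_le _ _).trans
    (mul_le_mul h h' (norm_nonneg _) ((norm_nonneg _).trans h))

theorem MemHInfty.add {Φ Ψ : UnitAddCircle → D →L[ℂ] E} (hΦ : MemHInfty Φ) (hΨ : MemHInfty Ψ) :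
    MemHInfty fun t => Φ t + Ψ t := by
  refine memHInfty_of_apply (fun x => (hΦ.apply x).add (hΨ.apply x)) ?_
  obtain ⟨C, hC⟩ := hΦ.bounded
  obtain ⟨C', hC'⟩ := hΨ.bounded
  refine ⟨C + C', ?_⟩
  filter_upwards [hC, hC'] with t h h'
  exact norm_add_le_of_le h h'

theorem MemHardy.smul [CompleteSpace E] {f : UnitAddCircle → E} (hf : MemHardy f) {q : ℂ → ℂ}
    (hq : DiffContOnCl ℂ q (Metric.ball 0 1)) :
    MemHardy fun t => q (AddCircle.toCircle t : ℂ) • f t :=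
  hf.hInfty_apply (memHInfty_smul_id hq)

/-- The Poisson integral of a vector-valued function. -/
noncomputable def poissonVec (f : UnitAddCircle → E) (ζ : ℂ) : E :=
  ∫ t, poissonKernel 0 ζ (AddCircle.toCircle t : ℂ) • f t ∂μ𝕋

theorem poissonIntegral_eq_poissonVec (Φ : UnitAddCircle → D →L[ℂ] E) (ζ : ℂ) (x : D) :
    poissonIntegral Φ ζ x = poissonVec (fun t => Φ t x) ζ := rfl

theorem poissonVec_congr_ae {f g : UnitAddCircle → E} (h : f =ᵐ[μ𝕋] g) (ζ : ℂ) :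
    poissonVec f ζ = poissonVec g ζ := by
  refine integral_congr_ae ?_
  filter_upwards [h] with t ht
  rw [ht]

theorem integrable_poissonKernel_smul {α : ℂ} (hα : ‖α‖ < 1) {f : UnitAddCircle → E}
    (hf : Integrable f μ𝕋) :
    Integrable (fun t => poissonKernel 0 α (AddCircle.toCircle t : ℂ) • f t) μ𝕋 := by
  have hk := continuous_poissonKernel_toCircle hα
  obtain ⟨C, hC⟩ := exists_norm_le_of_continuous hk
  exact Integrable.bdd_smul (𝕜 := ℝ) hf C hk.aestronglyMeasurable (Eventually.of_forall hC)

theorem poissonVec_of_diffContOnCl [CompleteSpace E] {α : ℂ} (hα : ‖α‖ < 1) {q : ℂ → E}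
    (hq : DiffContOnCl ℂ q (Metric.ball 0 1)) :
    poissonVec (fun t => q (AddCircle.toCircle t : ℂ)) α = q α :=
  integral_poissonKernel_smul hα hq

theorem poissonVec_const [CompleteSpace E] {α : ℂ} (hα : ‖α‖ < 1) (x : E) :
    poissonVec (fun _ => x) α = x :=
  poissonVec_of_diffContOnCl hα (q := fun _ => x) diffContOnCl_const

theorem poissonVec_clm_comp [CompleteSpace D] [CompleteSpace E] {α : ℂ} (hα : ‖α‖ < 1)
    (T : D →L[ℂ] E) {f : UnitAddCircle → D} (hf : Integrable f μ𝕋) :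
    poissonVec (fun t => T (f t)) α = T (poissonVec f α) := by
  rw [poissonVec, poissonVec, ← T.integral_comp_comm (integrable_poissonKernel_smul hα hf)]
  refine integral_congr_ae (Eventually.of_forall fun t => ?_)
  exact (T.map_smul_of_tower _ _).symm

theorem poissonVec_add {α : ℂ} (hα : ‖α‖ < 1) {f g : UnitAddCircle → E}
    (hf : Integrable f μ𝕋) (hg : Integrable g μ𝕋) :
    poissonVec (fun t => f t + g t) α = poissonVec f α + poissonVec g α := by
  simp only [poissonVec, smul_add]
  exact integral_add (integrable_poissonKernel_smul hα hf) (integrable_poissonKernel_smul hα hg)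

theorem poissonVec_sub {α : ℂ} (hα : ‖α‖ < 1) {f g : UnitAddCircle → E}
    (hf : Integrable f μ𝕋) (hg : Integrable g μ𝕋) :
    poissonVec (fun t => f t - g t) α = poissonVec f α - poissonVec g α := by
  simp only [poissonVec, smul_sub]
  exact integral_sub (integrable_poissonKernel_smul hα hf) (integrable_poissonKernel_smul hα hg)

/-- If the Poisson integral at `α` of `zᵐ K(z) x` vanishes for all `m` and `x`, then so does that
of `K f` for all `f` in the vector-valued Hardy space. -/
theorem poissonVec_clm_apply_eq_zero [CompleteSpace D] [CompleteSpace E] {α : ℂ} (hα : ‖α‖ < 1)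
    {K : UnitAddCircle → D →L[ℂ] E} (hK : ∀ x, AEStronglyMeasurable (fun t => K t x) μ𝕋)
    (hb : ∃ C : ℝ, ∀ᵐ t ∂μ𝕋, ‖K t‖ ≤ C)
    (h : ∀ (m : ℕ) (x : D),
      poissonVec (fun t => (AddCircle.toCircle t : ℂ) ^ m • K t x) α = 0)
    {f : UnitAddCircle → D} (hf : MemHardy f) : poissonVec (fun t => K t (f t)) α = 0 := by
  have hk := continuous_poissonKernel_toCircle hα
  refine MemHardy.integral_clm_apply_eq_zero
    (K := fun t => poissonKernel 0 α (AddCircle.toCircle t : ℂ) • K t)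
    (fun x => hk.aestronglyMeasurable.smul (hK x)) ?_ (fun m x => ?_) hf
  · obtain ⟨C, hC⟩ := hb
    obtain ⟨C', hC'⟩ := exists_norm_le_of_continuous hk
    refine ⟨C' * C, ?_⟩
    filter_upwards [hC] with t ht
    rw [norm_smul]
    exact mul_le_mul (hC' t) ht (norm_nonneg _) ((norm_nonneg _).trans (hC' t))
  · rw [← h m x]
    refine integral_congr_ae (Eventually.of_forall fun t => ?_)
    simp only [coe_fourier, zpow_natCast, smul_apply]
    rw [smul_comm]

/-- The kernel q - q(α) vanishes at α, so the Poisson formula annihilates its products with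
monomials, and density extends this to `f`. -/
theorem poissonVec_smul [CompleteSpace E] {α : ℂ} (hα : ‖α‖ < 1) {q : ℂ → ℂ}
    (hq : DiffContOnCl ℂ q (Metric.ball 0 1)) {f : UnitAddCircle → E} (hf : MemHardy f) :
    poissonVec (fun t => q (AddCircle.toCircle t : ℂ) • f t) α = q α • poissonVec f α := by
  have hd : DiffContOnCl ℂ (fun z => q z - q α) (Metric.ball 0 1) :=
    hq.sub diffContOnCl_const
  have hK := memHInfty_smul_id (E := E) hd
  have key := poissonVec_clm_apply_eq_zero hα hK.measurable hK.bounded (fun m x => ?_) hf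
  · rw [← sub_eq_zero, ← key]
    rw [show q α • poissonVec f α = (q α • ContinuousLinearMap.id ℂ E) (poissonVec f α) from rfl,
      ← poissonVec_clm_comp hα _ hf.integrable,
      ← poissonVec_sub hα (hf.smul hq).integrable]
    · simp [sub_smul]
    · exact ((q α • ContinuousLinearMap.id ℂ E).integrable_comp hf.integrable)
  · have := poissonVec_of_diffContOnCl hα (((diffContOnCl_pow m).smul hd).smul_const x)
    simp only [smul_eq_mul, sub_self, mul_zero, zero_smul] at this
    rw [← this]
    simp [smul_smul]

/-- The Poisson integral as a bounded operator. -/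
theorem exists_clm_poissonIntegral [CompleteSpace D] [CompleteSpace E] {α : ℂ} (hα : ‖α‖ < 1)
    {Φ : UnitAddCircle → D →L[ℂ] E} (hΦ : MemHInfty Φ) :
    ∃ T : D →L[ℂ] E, ∀ x, poissonVec (fun t => Φ t x) α = T x := by
  obtain ⟨C, hC⟩ := hΦ.bounded
  have hk := continuous_poissonKernel_toCircle hα
  obtain ⟨C', hC'⟩ := exists_norm_le_of_continuous hk
  let T₀ : D →ₗ[ℂ] E :=
    { toFun := fun x => poissonVec (fun t => Φ t x) α
      map_add' := fun x y => by
        simp only [map_add]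
        exact poissonVec_add hα (hΦ.apply x).integrable (hΦ.apply y).integrable
      map_smul' := fun c x => by
        simp only [map_smul]
        exact poissonVec_clm_comp hα (c • ContinuousLinearMap.id ℂ E) (hΦ.apply x).integrable }
  refine ⟨T₀.mkContinuous (C' * C) fun x => ?_, fun x => rfl⟩
  have := norm_integral_le_of_norm_le_const (μ := μ𝕋) (C := C' * C * ‖x‖)
    (f := fun t => poissonKernel 0 α (AddCircle.toCircle t : ℂ) • Φ t x) (by
      filter_upwards [hC] with t ht
      rw [norm_smul, mul_assoc]
      exact mul_le_mul (hC' t) ((Φ t).le_of_opNorm_le ht x) (norm_nonneg _)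
        ((norm_nonneg _).trans (hC' t)))
  rwa [probReal_univ, mul_one] at this

/-- Multiplicativity of the Poisson integral on `H^∞`. -/
theorem poissonVec_hInfty_apply [CompleteSpace D] [CompleteSpace E] {α : ℂ} (hα : ‖α‖ < 1)
    {Φ : UnitAddCircle → D →L[ℂ] E} (hΦ : MemHInfty Φ) {f : UnitAddCircle → D}
    (hf : MemHardy f) :
    poissonVec (fun t => Φ t (f t)) α = poissonIntegral Φ α (poissonVec f α) := by
  obtain ⟨T, hT⟩ := exists_clm_poissonIntegral hα hΦ
  -- Subtracting the value at α leaves a kernel vanishing at α, and it still does so after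
  -- multiplication by z^m, by `poissonVec_smul`.
  have hK : MemHInfty fun t => Φ t + -T := hΦ.add (memHInfty_const (-T))
  have key := poissonVec_clm_apply_eq_zero hα hK.measurable hK.bounded (fun m x => ?_) hf
  · rw [poissonIntegral_eq_poissonVec, hT, ← sub_eq_zero, ← key,
      ← poissonVec_clm_comp hα _ hf.integrable,
      ← poissonVec_sub hα (hf.hInfty_apply hΦ).integrable (T.integrable_comp hf.integrable)]
    simp [sub_eq_add_neg]
  · rw [poissonVec_smul hα (diffContOnCl_pow m) (hK.apply x)]
    have : poissonVec (fun t => (Φ t + -T) x) α = 0 := by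
      have := poissonVec_sub hα (hΦ.apply x).integrable (integrable_const (T x))
      rw [poissonVec_const hα, hT, sub_self] at this
      simpa [sub_eq_add_neg] using this
    rw [this, smul_zero]

end Hardy

/-! ### Blaschke factors -/

section Blaschke

open ComplexConjugate

variable {α z : ℂ}

theorem one_sub_conj_mul_ne_zero (hα : ‖α‖ < 1) (hz : ‖z‖ ≤ 1) : 1 - conj α * z ≠ 0 := by
  intro h
  have h1 : ‖conj α * z‖ = 1 := by rw [← sub_eq_zero.1 h, norm_one]
  rw [norm_mul, RCLike.norm_conj] at h1
  nlinarith [norm_nonneg α, norm_nonneg z]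

theorem conj_eq_inv_of_norm_eq_one (hz : ‖z‖ = 1) : conj z = z⁻¹ :=
  (Complex.inv_eq_conj hz).symm

theorem norm_sub_eq_norm_one_sub_conj_mul (hz : ‖z‖ = 1) : ‖1 - conj α * z‖ = ‖z - α‖ := by
  have h0 : z ≠ 0 := norm_ne_zero_iff.1 (hz ▸ one_ne_zero)
  have : 1 - conj α * z = z * conj (z - α) := by
    rw [map_sub, conj_eq_inv_of_norm_eq_one hz]
    field_simp
  rw [this, norm_mul, hz, one_mul, RCLike.norm_conj]

theorem norm_blaschkeFactor (hα : ‖α‖ < 1) (hz : ‖z‖ = 1) : ‖blaschkeFactor α z‖ = 1 := by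
  rw [blaschkeFactor, norm_div, norm_sub_eq_norm_one_sub_conj_mul hz, div_self]
  rw [← norm_sub_eq_norm_one_sub_conj_mul hz]
  exact norm_ne_zero_iff.2 (one_sub_conj_mul_ne_zero hα hz.le)

theorem blaschkeFactor_self (α : ℂ) : blaschkeFactor α α = 0 := by
  rw [blaschkeFactor, sub_self, zero_div]

theorem diffContOnCl_blaschkeFactor (hα : ‖α‖ < 1) :
    DiffContOnCl ℂ (blaschkeFactor α) (Metric.ball 0 1) := by
  refine DifferentiableOn.diffContOnCl ?_
  rw [closure_ball 0 one_ne_zero]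
  intro z hz
  refine DifferentiableAt.differentiableWithinAt ?_
  exact DifferentiableAt.div (by fun_prop) (by fun_prop)
    (one_sub_conj_mul_ne_zero hα (mem_closedBall_zero_iff.1 hz))

theorem diffContOnCl_blaschkeProduct (ν : ℂ) {n : ℕ} {a : Fin n → ℂ} (ha : ∀ m, ‖a m‖ < 1) :
    DiffContOnCl ℂ (fun z => ν * ∏ m, blaschkeFactor (a m) z) (Metric.ball 0 1) := by
  induction n with
  | zero => simpa using diffContOnCl_const
  | succ n ih =>
    simp only [Fin.prod_univ_succ]
    have := (diffContOnCl_blaschkeFactor (ha 0)).smul (ih (a := fun m => a m.succ) fun m => ha _)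
    convert this using 2
    simp only [smul_eq_mul]
    ring

/-- Since conj z = 1/z on the circle, the kernel becomes rational in z, so that its pole can be
matched with that of b_α⁻¹. -/
theorem ofReal_poissonKernel (hα : ‖α‖ < 1) (hz : ‖z‖ = 1) :
    (poissonKernel 0 α z : ℂ) = (1 - (‖α‖ : ℂ) ^ 2) * z / ((z - α) * (1 - conj α * z)) := by
  have h0 : z ≠ 0 := norm_ne_zero_iff.1 (hz ▸ one_ne_zero)
  have h1 : z - α ≠ 0 := sub_ne_zero.2 fun h => by rw [← h, hz] at hα; exact hα.false
  have h2 := one_sub_conj_mul_ne_zero hα hz.le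
  have h3 : (‖z - α‖ : ℂ) ^ 2 = (z - α) * (1 - conj α * z) / z := by
    rw [← Complex.mul_conj', map_sub, conj_eq_inv_of_norm_eq_one hz]
    field_simp
  rw [poissonKernel_def]
  push_cast
  rw [sub_zero, sub_zero, hz, h3]
  simp only [Complex.ofReal_one, one_pow]
  field_simp

end Blaschke

/-! ### Division by a Blaschke factor -/

section Division

open ComplexConjugate

variable {D E : Type*}
  [NormedAddCommGroup D] [InnerProductSpace ℂ D]
  [NormedAddCommGroup E] [InnerProductSpace ℂ E] [CompleteSpace E]

/-- A vector-valued Hardy function vanishing at `α` is divisible by the Blaschke factor `b_α`. -/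
theorem MemHardy.blaschkeFactor_inv_smul {α : ℂ} (hα : ‖α‖ < 1) {f : UnitAddCircle → E}
    (hf : MemHardy f) (h0 : poissonVec f α = 0) :
    MemHardy fun t => (blaschkeFactor α (AddCircle.toCircle t : ℂ))⁻¹ • f t where
  measurable := by
    have hc : Continuous fun t : UnitAddCircle =>
        (blaschkeFactor α (AddCircle.toCircle t : ℂ))⁻¹ :=
      (continuous_comp_toCircle (diffContOnCl_blaschkeFactor hα)).inv₀ fun t =>
        norm_ne_zero_iff.1 (by rw [norm_blaschkeFactor hα (norm_toCircle t)]; exact one_ne_zero)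
    exact hc.aestronglyMeasurable.smul hf.measurable
  bounded := by
    obtain ⟨C, hC⟩ := hf.bounded
    refine ⟨C, ?_⟩
    filter_upwards [hC] with t ht
    rwa [norm_smul, norm_inv, norm_blaschkeFactor hα (norm_toCircle t), inv_one, one_mul]
  analytic n hn := by
    obtain ⟨k, hk⟩ := Int.eq_ofNat_of_zero_le (show 0 ≤ -n - 1 by omega)
    have hn' : -n = (k : ℤ) + 1 := by omega
    -- This multiplier is chosen so that its product with the Poisson kernel is z^(k+1) b_α⁻¹ on the
    -- circle. The kernel supplies one factor z, hence k = -n - 1.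
    have hq : DiffContOnCl ℂ
        (fun z => (1 - (‖α‖ : ℂ) ^ 2)⁻¹ * (z ^ k * (1 - conj α * z) ^ 2)) (Metric.ball 0 1) :=
      Differentiable.diffContOnCl (by fun_prop)
    have key := poissonVec_smul hα hq hf
    rw [h0, smul_zero] at key
    rw [← key]
    refine integral_congr_ae (Eventually.of_forall fun t => ?_)
    have hz := norm_toCircle t
    simp only [coe_fourier, hn']
    set z : ℂ := (AddCircle.toCircle t : ℂ)
    rw [← Complex.coe_smul, smul_smul, smul_smul, ofReal_poissonKernel hα hz]
    congr 1
    have h1 : z - α ≠ 0 := sub_ne_zero.2 fun h => by rw [← h, hz] at hα; exact hα.false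
    have h2 := one_sub_conj_mul_ne_zero hα hz.le
    have h3 : 1 - (‖α‖ : ℂ) ^ 2 ≠ 0 := by
      norm_cast
      nlinarith [norm_nonneg α]
    have h4 : z ^ ((k : ℤ) + 1) = z ^ k * z := by norm_cast
    rw [h4, blaschkeFactor, inv_div]
    field_simp

theorem MemHInfty.blaschkeFactor_inv_smul {α : ℂ} (hα : ‖α‖ < 1)
    {Φ : UnitAddCircle → D →L[ℂ] E} (hΦ : MemHInfty Φ) (h0 : ∀ x, poissonIntegral Φ α x = 0) :
    MemHInfty fun t => (blaschkeFactor α (AddCircle.toCircle t : ℂ))⁻¹ • Φ t := by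
  refine memHInfty_of_apply (fun x => (hΦ.apply x).blaschkeFactor_inv_smul hα (h0 x)) ?_
  obtain ⟨C, hC⟩ := hΦ.bounded
  refine ⟨C, ?_⟩
  filter_upwards [hC] with t ht
  rwa [norm_smul, norm_inv, norm_blaschkeFactor hα (norm_toCircle t), inv_one, one_mul]

end Division

/-! ### Blaschke–Potapov divisors and necessity of dense range -/

section BlaschkePotapov

variable {D E : Type*}
  [NormedAddCommGroup D] [InnerProductSpace ℂ D]
  [NormedAddCommGroup E] [InnerProductSpace ℂ E] [CompleteSpace E]

/-- The Blaschke–Potapov factor `b_α Q + (1 - Q)`, where `Q` is the projection onto `K`. -/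
noncomputable def blaschkePotapov (α : ℂ) (K : Submodule ℂ E) [K.HasOrthogonalProjection]
    (t : UnitAddCircle) : E →L[ℂ] E :=
  blaschkeFactor α (AddCircle.toCircle t : ℂ) • K.starProjection + Kᗮ.starProjection

variable (K : Submodule ℂ E) [K.HasOrthogonalProjection]

theorem isInner_blaschkePotapov {α : ℂ} (hα : ‖α‖ < 1) : IsInner (blaschkePotapov α K) where
  mem := ((memHInfty_smul_id (diffContOnCl_blaschkeFactor hα)).comp
    (memHInfty_const K.starProjection)).add (memHInfty_const Kᗮ.starProjection)
  isometric x y := Eventually.of_forall fun t => by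
    have hb := norm_blaschkeFactor hα (norm_toCircle t)
    set b := blaschkeFactor α (AddCircle.toCircle t : ℂ)
    have hbb : b * (starRingEnd ℂ) b = 1 := by rw [Complex.mul_conj', hb]; norm_num
    have h1 (u v : E) : inner ℂ (K.starProjection u) (Kᗮ.starProjection v) = 0 :=
      K.inner_right_of_mem_orthogonal (K.starProjection_apply_mem u) (Kᗮ.starProjection_apply_mem v)
    have h2 (u v : E) : inner ℂ (Kᗮ.starProjection u) (K.starProjection v) = 0 :=
      K.inner_left_of_mem_orthogonal (K.starProjection_apply_mem v) (Kᗮ.starProjection_apply_mem u)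
    have hx := K.starProjection_add_starProjection_orthogonal x
    have hy := K.starProjection_add_starProjection_orthogonal y
    -- The right side does not involve c and d, so the case c = d = b can be compared with c = d =
    -- 1, where the sums are x and y.
    have expand (c d : ℂ) (h : d * (starRingEnd ℂ) c = 1) :
        inner ℂ (c • K.starProjection x + Kᗮ.starProjection x)
          (d • K.starProjection y + Kᗮ.starProjection y) =
        inner ℂ (K.starProjection x) (K.starProjection y) +
          inner ℂ (Kᗮ.starProjection x) (Kᗮ.starProjection y) := by
      simp only [inner_add_left, inner_add_right, inner_smul_left, inner_smul_right, h1, h2,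
        mul_zero, add_zero, zero_add, ← mul_assoc, h, one_mul]
    change inner ℂ (b • K.starProjection x + Kᗮ.starProjection x)
      (b • K.starProjection y + Kᗮ.starProjection y) = _
    rw [expand b b hbb, ← expand 1 1 (by simp), one_smul, one_smul, hx, hy]

/-- With Q the projection onto `K`, the quotient is b_α⁻¹QΦ + (1 - Q)Φ; it is analytic because QΦ
vanishes at α. -/
theorem isLeftInnerDivisor_blaschkePotapov {α : ℂ} (hα : ‖α‖ < 1)
    [CompleteSpace D] {Φ : UnitAddCircle → D →L[ℂ] E} (hΦ : MemHInfty Φ)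
    (h0 : ∀ x, K.starProjection (poissonIntegral Φ α x) = 0) :
    IsLeftInnerDivisor (blaschkePotapov α K) Φ := by
  refine ⟨isInner_blaschkePotapov K hα, fun t =>
    (blaschkeFactor α (AddCircle.toCircle t : ℂ))⁻¹ • (K.starProjection ∘L Φ t) +
      Kᗮ.starProjection ∘L Φ t, ?_, ?_⟩
  · refine MemHInfty.add (MemHInfty.blaschkeFactor_inv_smul hα
      ((memHInfty_const _).comp hΦ) fun x => ?_) ((memHInfty_const _).comp hΦ)
    rw [← h0 x]
    exact poissonVec_clm_comp hα K.starProjection (hΦ.apply x).integrable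
  · refine fun x => Eventually.of_forall fun t => ?_
    have hb0 : blaschkeFactor α (AddCircle.toCircle t : ℂ) ≠ 0 :=
      norm_ne_zero_iff.1 (by rw [norm_blaschkeFactor hα (norm_toCircle t)]; exact one_ne_zero)
    set y := Φ t x with hy
    have e1 : K.starProjection (Kᗮ.starProjection y) = 0 :=
      K.starProjection_apply_eq_zero_iff.2 (Kᗮ.starProjection_apply_mem y)
    have e2 : Kᗮ.starProjection (K.starProjection y) = 0 :=
      Kᗮ.starProjection_apply_eq_zero_iff.2
        (K.le_orthogonal_orthogonal (K.starProjection_apply_mem y))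
    have e3 : K.starProjection (K.starProjection y) = K.starProjection y :=
      K.starProjection_eq_self_iff.2 (K.starProjection_apply_mem y)
    have e4 : Kᗮ.starProjection (Kᗮ.starProjection y) = Kᗮ.starProjection y :=
      Kᗮ.starProjection_eq_self_iff.2 (Kᗮ.starProjection_apply_mem y)
    simp only [blaschkePotapov, ContinuousLinearMap.comp_apply, add_apply,
      smul_apply, map_add, map_smul, ← hy, e1, e2, e3, e4, smul_zero,
      add_zero, zero_add, smul_smul, inv_mul_cancel₀ hb0, one_smul]
    exact (K.starProjection_add_starProjection_orthogonal y).symm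

/-- Evaluation at α kills every vector of `K`, whereas a constant unitary V evaluates to V, which is
injective. -/
theorem not_isUnitaryConstant_blaschkePotapov {α : ℂ} (hα : ‖α‖ < 1) (hK : K ≠ ⊥) :
    ¬ IsUnitaryConstant (blaschkePotapov α K) := by
  rintro ⟨V, hV, hVeq⟩
  obtain ⟨x, hxK, hx0⟩ := K.exists_mem_ne_zero_of_ne_bot hK
  have hx : ∀ t, blaschkePotapov α K t x = blaschkeFactor α (AddCircle.toCircle t : ℂ) • x := by
    intro t
    simp only [blaschkePotapov, add_apply, smul_apply, K.starProjection_eq_self_iff.2 hxK,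
      Kᗮ.starProjection_apply_eq_zero_iff.2 (K.le_orthogonal_orthogonal hxK), add_zero]
  have hP : poissonVec (fun t => blaschkePotapov α K t x) α = V x := by
    rw [poissonVec_congr_ae (hVeq x), poissonVec_const hα]
  simp only [hx] at hP
  rw [poissonVec_of_diffContOnCl hα ((diffContOnCl_blaschkeFactor hα).smul_const x),
    blaschkeFactor_self, zero_smul] at hP
  have : (star V * V) x = x := by rw [Unitary.star_mul_self_of_mem hV]; rfl
  rw [mul_apply_eq_comp, ← hP, map_zero] at this
  exact hx0 this.symm

theorem denseRange_poissonIntegral_of_leftCoprime {Φ : UnitAddCircle → E →L[ℂ] E}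
    (hΦ : MemHInfty Φ) {θ : ℂ → ℂ} (hθ : DiffContOnCl ℂ θ (Metric.ball 0 1))
    (h : LeftCoprime Φ
      fun t => θ (AddCircle.toCircle t : ℂ) • ContinuousLinearMap.id ℂ E)
    {α : ℂ} (hα : ‖α‖ < 1) (h0 : θ α = 0) : DenseRange (poissonIntegral Φ α) := by
  obtain ⟨T, hT⟩ := exists_clm_poissonIntegral hα hΦ
  have hT' : poissonIntegral Φ α = T := funext hT
  by_contra hd
  set S := T.range.topologicalClosure
  have hS : S ≠ ⊤ := by
    intro hS
    refine hd ?_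
    rw [hT', DenseRange, dense_iff_closure_eq]
    exact congrArg (fun S : Submodule ℂ E => (S : Set E)) hS
  have : CompleteSpace S := T.range.isClosed_topologicalClosure.completeSpace_coe
  have hK : Sᗮ ≠ ⊥ := fun hb => hS (S.orthogonal_eq_bot_iff.1 hb)
  refine h ⟨blaschkePotapov α Sᗮ, ⟨isLeftInnerDivisor_blaschkePotapov Sᗮ hα hΦ fun x => ?_,
    not_isUnitaryConstant_blaschkePotapov Sᗮ hα hK⟩,
    ⟨isLeftInnerDivisor_blaschkePotapov Sᗮ hα (memHInfty_smul_id hθ) fun x => ?_,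
    not_isUnitaryConstant_blaschkePotapov Sᗮ hα hK⟩⟩
  · refine Sᗮ.starProjection_apply_eq_zero_iff.2 (S.le_orthogonal_orthogonal ?_)
    rw [hT']
    exact T.range.le_topologicalClosure ⟨x, rfl⟩
  · have : poissonIntegral
        (fun t => θ (AddCircle.toCircle t : ℂ) • ContinuousLinearMap.id ℂ E) α x = 0 := by
      rw [poissonIntegral_eq_poissonVec]
      refine (poissonVec_of_diffContOnCl hα (hθ.smul_const x)).trans ?_
      rw [h0, zero_smul]
    rw [this, map_zero]

end BlaschkePotapov

/-! ### Removing Blaschke factors and sufficiency of dense range -/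

section Divisors

variable {E : Type*} [NormedAddCommGroup E] [InnerProductSpace ℂ E] [CompleteSpace E]

/-- An inner function with a right inverse in `H^∞` is a unitary constant. -/
theorem IsInner.isUnitaryConstant_of_comp_eq_const {Δ B : UnitAddCircle → E →L[ℂ] E}
    (hΔ : IsInner Δ) (hB : MemHInfty B) {ν : ℂ} (hν : ‖ν‖ = 1)
    (h : ∀ x, ∀ᵐ t ∂μ𝕋, Δ t (B t x) = ν • x) : IsUnitaryConstant Δ := by
  have hν0 : ν ≠ 0 := norm_ne_zero_iff.1 (hν ▸ one_ne_zero)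
  -- From νy = ΔBy and isometry, ⟨νy, Δx⟩ = ⟨By, x⟩: positive coefficients of Δx pair to conjugates
  -- of negative coefficients of By, which vanish.
  have coeff_pos : ∀ x n, 0 < n → fourierCoeff (fun t => Δ t x) n = 0 := by
    intro x n hn
    refine ext_inner_left ℂ fun y => ?_
    have h1 : inner ℂ (ν • y) (fourierCoeff (fun t => Δ t x) n) =
        (starRingEnd ℂ) (inner ℂ x (fourierCoeff (fun t => B t y) (-n))) := by
      rw [← inner_fourierCoeff (hΔ.mem.apply x).integrable,
        ← inner_fourierCoeff (hB.apply y).integrable, fourierCoeff, fourierCoeff, ← integral_conj]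
      refine integral_congr_ae ?_
      filter_upwards [h y, hΔ.ae_inner_apply (hB.measurable y)
        (aestronglyMeasurable_const (b := x))] with t ht ht'
      rw [smul_eq_mul, smul_eq_mul, map_mul, inner_conj_symm, ← fourier_neg, neg_neg, ← ht, ht']
    rw [hB.analytic (-n) (by omega) y, inner_zero_right, map_zero, inner_smul_left] at h1
    rw [inner_zero_right]
    exact (mul_eq_zero.1 h1).resolve_left ((map_ne_zero _).2 hν0)
  have const_ae : ∀ x, ∀ᵐ t ∂μ𝕋, Δ t x = fourierCoeff (fun t => Δ t x) 0 := by
    intro x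
    set c := fourierCoeff (fun t => Δ t x) 0 with hc
    have hlp : MemLp (fun t => Δ t x - c) 2 μ𝕋 :=
      ((hΔ.mem.apply x).memLp 2).sub (memLp_const c)
    have := ae_eq_zero_of_fourierCoeff_eq_zero hlp fun n => ?_
    · filter_upwards [this] with t ht
      exact sub_eq_zero.1 ht
    · have hconst : fourierCoeff (fun _ : UnitAddCircle => c) n = if n = 0 then c else 0 := by
        have := congrFun (fourierCoeff_fourier (T := 1) 0) n
        simp only [fourierCoeff, fourier_zero, smul_eq_mul, mul_one] at this
        rw [fourierCoeff, integral_smul_const, this]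
        split_ifs with h
        · rw [h, Pi.single_eq_same, one_smul]
        · rw [Pi.single_eq_of_ne h, zero_smul]
      have hsub : fourierCoeff (fun t => Δ t x - c) n =
          fourierCoeff (fun t => Δ t x) n - fourierCoeff (fun _ : UnitAddCircle => c) n := by
        simp only [fourierCoeff, smul_sub]
        exact integral_sub ((hΔ.mem.apply x).integrable.fourier_smul _)
          ((integrable_const c).fourier_smul _)
      rw [hsub, hconst]
      rcases lt_trichotomy n 0 with hn | hn | hn
      · rw [hΔ.mem.analytic n hn, if_neg hn.ne, sub_zero]
      · rw [hn, if_pos rfl, ← hc, sub_self]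
      · rw [coeff_pos x n hn, if_neg hn.ne', sub_zero]
  -- The constants depend on x; the Poisson integral packages them into one bounded operator.
  obtain ⟨V, hV⟩ := exists_clm_poissonIntegral (α := 0) (by simp) hΔ.mem
  have hΔV : StrongEq Δ fun _ => V := by
    intro x
    have : V x = fourierCoeff (fun t => Δ t x) 0 := by
      rw [← hV, poissonVec_congr_ae (const_ae x), poissonVec_const (by simp)]
    simpa only [this] using const_ae x
  refine ⟨V, ?_, hΔV⟩
  have hiso : ∀ x, (star V * V) x = x := by
    intro x
    refine ext_inner_right ℂ fun y => ?_
    obtain ⟨t, h1, h2, h3⟩ := ((hΔV x).and ((hΔV y).and (hΔ.isometric x y))).exists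
    rw [mul_apply_eq_comp, ContinuousLinearMap.star_eq_adjoint,
      ContinuousLinearMap.adjoint_inner_left, ← h3, h1, h2]
  -- An isometry need not be unitary in infinite dimensions; the right inverse supplies
  -- surjectivity.
  have hsurj : Function.Surjective V := by
    intro x
    obtain ⟨t, h1, h2⟩ := ((hΔV.ae_apply (hB.measurable x)).and (h x)).exists
    refine ⟨ν⁻¹ • B t x, ?_⟩
    rw [map_smul, ← h1, h2, inv_smul_smul₀ hν0]
  refine Unitary.mem_iff.2 ⟨ContinuousLinearMap.ext hiso, ContinuousLinearMap.ext fun y => ?_⟩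
  obtain ⟨x, rfl⟩ := hsurj y
  exact congrArg V (hiso x)

/-- An inner function with a right inverse up to a continuous scalar function also has a left inverse
up to this function. -/
theorem IsInner.comp_eq_smul {E : Type*} [NormedAddCommGroup E] [InnerProductSpace ℂ E]
    {Δ B : UnitAddCircle → E →L[ℂ] E} (hΔ : IsInner Δ)
    (hB : MemHInfty B) {q : UnitAddCircle → ℂ} (hq : Continuous q)
    (h : ∀ x, ∀ᵐ t ∂μ𝕋, Δ t (B t x) = q t • x) (x : E) :
    ∀ᵐ t ∂μ𝕋, B t (Δ t x) = q t • x := by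
  -- Applying ΔB = q to the function Δx gives Δ(BΔx - qx) = 0, and Δ preserves norms.
  have h1 := StrongEq.ae_apply (Φ := fun t => Δ t ∘L B t)
    (Ψ := fun t => q t • ContinuousLinearMap.id ℂ E) h (hΔ.mem.measurable x)
  have hm : AEStronglyMeasurable (fun t => B t (Δ t x) - q t • x) μ𝕋 :=
    (aestronglyMeasurable_clm_apply hB.measurable (hΔ.mem.measurable x)).sub
      (hq.smul continuous_const).aestronglyMeasurable
  filter_upwards [h1, hΔ.ae_norm_apply hm] with t ht hn
  have ht' : Δ t (B t (Δ t x)) = q t • Δ t x := ht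
  rw [map_sub, map_smul, ht', sub_self, norm_zero] at hn
  exact sub_eq_zero.1 (norm_eq_zero.1 hn.symm)

/-- Induction on the number of factors: BΔ is also the scalar product, so P[B](a₀) vanishes on the
dense range of P[Δ](a₀), hence everywhere. Dividing `B` by the first factor leaves the same equation
for the remaining ones, with Δ unchanged. -/
theorem IsInner.isUnitaryConstant_of_comp_eq_blaschkeProduct {Δ : UnitAddCircle → E →L[ℂ] E}
    (hΔ : IsInner Δ) {ν : ℂ} (hν : ‖ν‖ = 1) {n : ℕ} {a : Fin n → ℂ} (ha : ∀ m, ‖a m‖ < 1)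
    (hd : ∀ m, DenseRange (poissonIntegral Δ (a m))) {B : UnitAddCircle → E →L[ℂ] E}
    (hB : MemHInfty B)
    (h : ∀ x, ∀ᵐ t ∂μ𝕋, Δ t (B t x) =
      (ν * ∏ m, blaschkeFactor (a m) (AddCircle.toCircle t : ℂ)) • x) :
    IsUnitaryConstant Δ := by
  induction n generalizing B with
  | zero => exact hΔ.isUnitaryConstant_of_comp_eq_const hB hν (by simpa using h)
  | succ n ih =>
    have hθ := diffContOnCl_blaschkeProduct ν ha
    have hB0 : ∀ x, poissonIntegral B (a 0) x = 0 := by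
      obtain ⟨T, hT⟩ := exists_clm_poissonIntegral (ha 0) hB
      have hT' : poissonIntegral B (a 0) = T := funext hT
      rw [hT']
      refine fun x => congrFun ((hd 0).equalizer T.continuous continuous_const (funext fun y => ?_)) x
      rw [Function.comp_apply, Function.comp_apply, ← hT', poissonIntegral_eq_poissonVec Δ,
        ← poissonVec_hInfty_apply (ha 0) hB (hΔ.mem.apply y),
        poissonVec_congr_ae (hΔ.comp_eq_smul hB (continuous_comp_toCircle hθ) h y),
        poissonVec_of_diffContOnCl (ha 0) (hθ.smul_const y), Fin.prod_univ_succ,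
        blaschkeFactor_self, zero_mul, mul_zero, zero_smul]
    refine ih (a := fun m => a m.succ) (fun m => ha _) (fun m => hd _)
      (hB.blaschkeFactor_inv_smul (ha 0) hB0) fun x => ?_
    filter_upwards [h x] with t ht
    have hb0 : blaschkeFactor (a 0) (AddCircle.toCircle t : ℂ) ≠ 0 :=
      norm_ne_zero_iff.1 (by rw [norm_blaschkeFactor (ha 0) (norm_toCircle t)]; exact one_ne_zero)
    rw [smul_apply, map_smul, ht, smul_smul, Fin.prod_univ_succ]
    congr 1
    field_simp

/-- By multiplicativity the range of P[Φ] at each `a m` lies in that of P[Δ], for any left inner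
divisor Δ of Φ, so density is inherited. -/
theorem leftCoprime_of_denseRange_poissonIntegral {Φ : UnitAddCircle → E →L[ℂ] E}
    {ν : ℂ} (hν : ‖ν‖ = 1) {n : ℕ} {a : Fin n → ℂ} (ha : ∀ m, ‖a m‖ < 1)
    (hd : ∀ m, DenseRange (poissonIntegral Φ (a m))) :
    LeftCoprime Φ fun t => (ν * ∏ m, blaschkeFactor (a m) (AddCircle.toCircle t : ℂ)) •
      ContinuousLinearMap.id ℂ E := by
  rintro ⟨Δ, ⟨⟨hΔ, A, hA, hΦA⟩, hne⟩, ⟨⟨-, B, hB, hΘB⟩, -⟩⟩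
  refine hne (hΔ.isUnitaryConstant_of_comp_eq_blaschkeProduct hν ha (fun m => ?_) hB fun x => ?_)
  · refine (hd m).mono ?_
    rintro _ ⟨x, rfl⟩
    rw [poissonIntegral_eq_poissonVec, poissonVec_congr_ae (hΦA x)]
    exact ⟨_, (poissonVec_hInfty_apply (ha m) hΔ.mem (hA.apply x)).symm⟩
  · filter_upwards [hΘB x] with t ht
    exact ht.symm

end Divisors

end OpHardy

theorem theorem4p2 {E : Type*} [NormedAddCommGroup E] [InnerProductSpace ℂ E] [CompleteSpace E]
    (Φ : UnitAddCircle → E →L[ℂ] E) (hΦ : OpHardy.MemHInfty Φ)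
    (θ : ℂ → ℂ) (hθ : OpHardy.IsFiniteBlaschkeProduct θ) :
    OpHardy.LeftCoprime Φ
        (fun t => θ (AddCircle.toCircle t : ℂ) • ContinuousLinearMap.id ℂ E) ↔
      ∀ α : ℂ, ‖α‖ < 1 → θ α = 0 → DenseRange (OpHardy.poissonIntegral Φ α) := by
  obtain ⟨ν, n, a, hν, ha, hθa⟩ := hθ
  have hcircle : ∀ t : UnitAddCircle, θ (AddCircle.toCircle t : ℂ) =
      ν * ∏ m, OpHardy.blaschkeFactor (a m) (AddCircle.toCircle t : ℂ) := fun t =>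
    hθa _ (OpHardy.norm_toCircle t).le
  simp only [hcircle]
  constructor
  · intro h α hα h0
    exact OpHardy.denseRange_poissonIntegral_of_leftCoprime hΦ
      (OpHardy.diffContOnCl_blaschkeProduct ν ha) h hα (by rw [← hθa α hα.le, h0])
  · intro h
    refine OpHardy.leftCoprime_of_denseRange_poissonIntegral hν ha fun m => h _ (ha m) ?_
    rw [hθa _ (ha m).le, Finset.prod_eq_zero (Finset.mem_univ m) (OpHardy.blaschkeFactor_self _),
      mul_zero]
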